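/- Let $n\ge 1$ and let $f:\{1,\dots,n\}\to\mathbb{N}$ be non-decreasing with $f(k)\ge k$ for all $k\in\{1,\dots,n\}$ and $f(1)\le n-1$. Let $$d'=\min\bigl(\{n\}\cup\{x\in\{1,\dots,n\} : f(x)\ge 2n\}\bigr).$$ Consider an asynchronous shared memory system with $n$ processes (each knowing its own identifier) that communicate only through atomic multi-reader/multi-writer registers, where each process calls the operation getName at most once, and a step of a process is either its invocation of getName or one read or write of a register, followed by local computation up to its next shared memory operation or its return. Then there is a deterministic algorithm for getName that uses $d'+1$ bounded registers (each register takes values in a fixed finite set) and that is 1. a one-shot $f$-adaptive renaming algorithm: in no reachable configuration have two different processes been returned the same name, and whenever the getName of a process completes, the name it returns lies in $\{1,\dots,f(k)\}$, where $k$ is the number of processes that have invoked getName by the time it completes; 2. obstruction-free: from every reachable configuration $C$ and for every process $p$, there is a finite schedule starting at $C$, consisting only of steps of $p$, after which the getName of $p$ has completed. -/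

import Mathlib

namespace Renaming

/-- The next shared memory operation of a running process, together with the outcome of all the
local computation that follows it up to the next shared memory operation. An outcome is
`Sum.inl s` (the process is still running, in local state `s`) or `Sum.inr x` (its `getName`
returns the name `x`). There are `m` registers, with values in `V`; `L` is the type of local
states. -/
inductive Instr (m : ℕ) (V L : Type) : Type where
  /-- Read register `r`; the outcome depends on the value that is read. -/
  | read (r : Fin m) (next : V → L ⊕ ℕ)
  /-- Write `v` to register `r`. -/
  | write (r : Fin m) (v : V) (next : L ⊕ ℕ)

/-- A deterministic one-shot `getName` algorithm for the `n` processes `Fin n`, from `m` atomic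
multi-reader/multi-writer registers with values in `V`. The code of a process may depend on its
identifier. -/
structure Algorithm (n m : ℕ) (V : Type) : Type 1 where
  /-- Local states of running processes. -/
  Local : Type
  /-- Initial contents of the registers. -/
  initReg : Fin m → V
  /-- Outcome of the invocation of `getName` (and the local computation that follows it). -/
  invoke : Fin n → Local ⊕ ℕ
  /-- The instruction that a process is poised to execute in a given local state. -/
  code : Fin n → Local → Instr m V Local

/-- The state of a process: it has not invoked `getName` yet, or it is executing `getName` in
local state `s`, or its `getName` has returned the name `x`. -/
inductive Status (L : Type) : Type where
  | idle
  | active (s : L)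
  | named (x : ℕ)

/-- The state of a process after an outcome. -/
def Status.ofOutcome {L : Type} : L ⊕ ℕ → Status L
  | Sum.inl s => Status.active s
  | Sum.inr x => Status.named x

namespace Algorithm

variable {n m : ℕ} {V : Type} (A : Algorithm n m V)

/-- A configuration: the states of all processes and the contents of all registers. -/
structure Config : Type where
  proc : Fin n → Status A.Local
  reg : Fin m → V

/-- The initial configuration. -/
def initConfig : A.Config where
  proc := fun _ => Status.idle
  reg := A.initReg

/-- The configuration that results from one step of process `p`: the invocation of `getName` if
`p` is idle, its next shared memory operation if it is running. `getName` is invoked at most once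
by each process, so a process that has its name takes no further steps (scheduling it changes
nothing). -/
def step (C : A.Config) (p : Fin n) : A.Config :=
  match C.proc p with
  | Status.idle =>
      { proc := Function.update C.proc p (Status.ofOutcome (A.invoke p))
        reg := C.reg }
  | Status.active s =>
      match A.code p s with
      | Instr.read r next =>
          { proc := Function.update C.proc p (Status.ofOutcome (next (C.reg r)))
            reg := C.reg }
      | Instr.write r v next =>
          { proc := Function.update C.proc p (Status.ofOutcome next)
            reg := Function.update C.reg r v }
  | Status.named _ => C

/-- The final configuration of the execution that starts at `C` and arises from the finite
schedule `σ`. -/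
def run (C : A.Config) (σ : List (Fin n)) : A.Config :=
  σ.foldl A.step C

/-- `C` is reachable from the initial configuration by a finite schedule. -/
def Reachable (C : A.Config) : Prop :=
  ∃ σ : List (Fin n), A.run A.initConfig σ = C

variable {A}

/-- The `getName` of process `p` has returned the name `x` in `C`. -/
def Config.Owns (C : A.Config) (p : Fin n) (x : ℕ) : Prop :=
  C.proc p = Status.named x

/-- The `getName` of process `p` has returned in `C`. -/
def Config.Finished (C : A.Config) (p : Fin n) : Prop :=
  ∃ x, C.Owns p x

/-- Process `p` participates in `C`: it has started its `getName` (there is no release of names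
in one-shot renaming). -/
def Config.Participates (C : A.Config) (p : Fin n) : Prop :=
  C.proc p ≠ Status.idle

/-- The number of participants in `C`. -/
noncomputable def Config.numParticipants (C : A.Config) : ℕ :=
  {p : Fin n | C.Participates p}.ncard

variable (A)

/-- The algorithm solves one-shot `b`-bounded `f`-adaptive renaming. In the one-shot case the
number `k` of participants during the `getName` of `p` is the number of processes that have
started `getName` by the time the one of `p` completes, that is, the number of participants in
the configuration right after the step by which `p` completes. -/
structure IsBoundedAdaptiveRenaming (b : ℕ) (f : ℕ → ℕ) : Prop where
  /-- In no reachable configuration do two processes own the same name. -/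
  distinct : ∀ C, A.Reachable C → ∀ (p q : Fin n) (x : ℕ), C.Owns p x → C.Owns q x → p = q
  /-- If there are `k ≤ b` participants during the `getName` of `p`, it returns a name in
  `{1, …, f k}`. -/
  adaptive : ∀ C, A.Reachable C → ∀ (p : Fin n) (x : ℕ), ¬ C.Finished p →
    (A.step C p).Owns p x → (A.step C p).numParticipants ≤ b →
      x ∈ Set.Icc 1 (f (A.step C p).numParticipants)

/-- One-shot `f`-adaptive renaming for `n` processes is the `n`-bounded version. -/
def IsAdaptiveRenaming (f : ℕ → ℕ) : Prop :=
  A.IsBoundedAdaptiveRenaming n f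

/-- From every reachable configuration, every process has a finite solo schedule that completes
its `getName`. -/
def ObstructionFree : Prop :=
  ∀ C, A.Reachable C → ∀ p : Fin n,
    ∃ σ : List (Fin n), (∀ q ∈ σ, q = p) ∧ (A.run C σ).Finished p

end Algorithm

end Renaming

/-! ### The algorithm: histories, double collects and adoption. -/

namespace Renaming

/-! Small names are positions in a history that processes agree on. A process repeats double
collects. It returns its position in `h` once it sees its own value `(q, h)` everywhere. Otherwise
it adopts, extended by itself, the history of a candidate. If that changes its history, it
overwrites its own last write. If not, it spreads its history to one more register. Without a
candidate the `d + 1` registers show `d + 1` different writers, and it returns its private name `n +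
1 + q`, which is at most `2 * n`.

Agreement: suppose that all registers contain `(p, X)` and that `p` writes no more. The first write
of another process may have been prepared earlier and need not extend `X`. Afterwards it collects
afresh, and a verified double collect shows any value that does not extend `X` as the only one of
its writer. Hence every candidate extends `X`, and the process replaces its stale value by an
extension of `X`. So a process never holds two registers while one of them fails to extend `X`, and
with at least two registers nobody can fill them all with such a history (`SecuredSince`,
`Secured.prefix_of_forall_reg`). A process that reads its own value everywhere had filled all
registers when its first pass began, since nobody else writes values under its identifier
(`Locked.of_step`). Thus the histories used for returning are pairwise comparable prefixes, and
equal positions in them belong to the same process (`Invariant.distinct`).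

Adaptivity: histories are duplicate-free lists of participants, so with `k` participants a position
is at most `k`, hence at most `f k`. A private name requires `k > d`. This is impossible for `d =
n`; otherwise `2 * n ≤ f d ≤ f k`.

Obstruction-freedom: a solo process adopts some history, after its next write adopts the same one
again, and so spreads to a second register. From then on its own last write is a candidate and it
fills all registers (`soloFrom_start_of_two`, `soloFrom_start_of_written`). -/

/-- A history: the list of the processes that hold the names `1, 2, …`, in this order. -/
abbrev Hist (n : ℕ) : Type := {l : List (Fin n) // l.Nodup}

/-- Register contents: nothing, or a writer together with the history that it proposes. -/
abbrev RegVal (n : ℕ) : Type := Option (Fin n × Hist n)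

/-- Append `q` to a history, unless it is already present. -/
def Hist.extend {n : ℕ} (q : Fin n) (h : Hist n) : Hist n :=
  if hq : q ∈ h.1 then h
  else ⟨h.1 ++ [q], List.nodup_append.2 ⟨h.2, List.nodup_singleton q, by
    intro a ha b hb
    rw [List.mem_singleton.1 hb]
    rintro rfl
    exact hq ha⟩⟩

theorem Hist.mem_extend {n : ℕ} (q : Fin n) (h : Hist n) : q ∈ (h.extend q).1 := by
  unfold Hist.extend
  split_ifs with hq <;> simp [hq]

theorem Hist.extend_of_mem {n : ℕ} {q : Fin n} {h : Hist n} (hq : q ∈ h.1) : h.extend q = h := by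
  simp [Hist.extend, hq]

theorem Hist.prefix_extend {n : ℕ} (q : Fin n) (h : Hist n) : h.1 <+: (h.extend q).1 := by
  unfold Hist.extend
  split_ifs with hq <;> simp

theorem Hist.mem_of_mem_extend {n : ℕ} {q x : Fin n} {h : Hist n} (hx : x ∈ (h.extend q).1) :
    x = q ∨ x ∈ h.1 := by
  unfold Hist.extend at hx
  split_ifs at hx with hq
  · exact Or.inr hx
  · simpa [or_comm] using hx

/-- The history stored in a register, empty for a register that was never written. -/
def RegVal.hist {n : ℕ} : RegVal n → Hist n
  | none => ⟨[], List.nodup_nil⟩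
  | some (_, h) => h

/-- The writers of the values in a collect. -/
def writers {n m : ℕ} (c : Fin m → RegVal n) : Fin m → Option (Fin n) :=
  fun a => (c a).map Prod.fst

/-- An entry is a candidate for adoption when it is blank or shares its writer with another one. -/
def Candidate {n m : ℕ} (w : Fin m → Option (Fin n)) (j : Fin m) : Prop :=
  w j = none ∨ ∃ b, b ≠ j ∧ w b = w j

/-- Local states of a running process. In each of them `i` is the register that is written last
(or is about to be written), `h` is the history written there. A process reads all registers into
`c`, verifies that a second pass shows the same values, and then writes or returns. -/
inductive LocalState (n d : ℕ) : Type where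
  | collect (i : Fin (d + 1)) (h : Hist n) (c : Fin (d + 1) → RegVal n) (t : Fin (d + 1))
  | verify (i : Fin (d + 1)) (h : Hist n) (c : Fin (d + 1) → RegVal n) (t : Fin (d + 1))
  | write (i : Fin (d + 1)) (h : Hist n)

/-- The start of a collect. -/
def LocalState.start {n d : ℕ} (i : Fin (d + 1)) (h : Hist n) : LocalState n d :=
  .collect i h (fun _ => none) 0

open Classical in
/-- The entry of a collect that process `q` adopts: its own last write if that is a candidate, and
otherwise one that depends on the writers only. -/
noncomputable def adopted {n d : ℕ} (q : Fin n) (i : Fin (d + 1))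
    (w : Fin (d + 1) → Option (Fin n)) (hw : ∃ j, Candidate w j) : Fin (d + 1) :=
  if w i = some q ∧ Candidate w i then i else hw.choose

theorem candidate_adopted {n d : ℕ} (q : Fin n) (i : Fin (d + 1))
    (w : Fin (d + 1) → Option (Fin n)) (hw : ∃ j, Candidate w j) :
    Candidate w (adopted q i w hw) := by
  unfold adopted
  split_ifs with h
  · exact h.2
  · exact hw.choose_spec

open Classical in
/-- What process `q` does after a successful double collect `c`. -/
noncomputable def decision {n d : ℕ} (q : Fin n) (i : Fin (d + 1)) (h : Hist n)
    (c : Fin (d + 1) → RegVal n) : LocalState n d ⊕ ℕ :=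
  if hall : ∀ a, c a = some (q, h) then Sum.inr (h.1.idxOf q + 1)
  else if hw : ∃ j, Candidate (writers c) j then
    if (RegVal.hist (c (adopted q i (writers c) hw))).extend q = h then
      Sum.inl (.write (not_forall.1 hall).choose h)
    -- Reusing register `i` removes the outdated value of `q`, so that `q` never holds two registers
    -- while one is outdated. It also leaves the pattern of writers unchanged if `i` still belongs
    -- to `q`.
    else Sum.inl (.write i ((RegVal.hist (c (adopted q i (writers c) hw))).extend q))
  -- The offset keeps these names above every position in a history, since those are at most `n`.
  else Sum.inr (n + 1 + q)

/-- Outcome of reading `v` from register `t` in the first pass. -/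
def collectNext {n d : ℕ} (i : Fin (d + 1)) (h : Hist n) (c : Fin (d + 1) → RegVal n)
    (t : Fin (d + 1)) (v : RegVal n) : LocalState n d :=
  if ht : t.1 + 1 < d + 1 then .collect i h (Function.update c t v) ⟨t.1 + 1, ht⟩
  else .verify i h (Function.update c t v) 0

open Classical in
/-- Outcome of reading `v` from register `t` in the second pass. -/
noncomputable def verifyNext {n d : ℕ} (q : Fin n) (i : Fin (d + 1)) (h : Hist n)
    (c : Fin (d + 1) → RegVal n) (t : Fin (d + 1)) (v : RegVal n) : LocalState n d ⊕ ℕ :=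
  if v = c t then
    if ht : t.1 + 1 < d + 1 then Sum.inl (.verify i h c ⟨t.1 + 1, ht⟩) else decision q i h c
  else Sum.inl (.start i h)

/-- The renaming algorithm for `n` processes with `d + 1` registers. -/
noncomputable def renamingAlg (n d : ℕ) : Algorithm n (d + 1) (RegVal n) where
  Local := LocalState n d
  initReg := fun _ => none
  invoke := fun _ => Sum.inl (.start 0 ⟨[], List.nodup_nil⟩)
  code := fun q s => match s with
    | .collect i h c t => Instr.read t fun v => Sum.inl (collectNext i h c t v)
    | .verify i h c t => Instr.read t fun v => verifyNext q i h c t v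
    | .write i h =>
        Instr.write i (some (q, h.extend q)) (Sum.inl (.start i (h.extend q)))

/-! ### The effect of a single step. -/

section Steps

variable {n d : ℕ} {C : (renamingAlg n d).Config} {q : Fin n}

theorem step_idle (hq : C.proc q = Status.idle) : (renamingAlg n d).step C q =
    ⟨Function.update C.proc q (Status.active (LocalState.start 0 ⟨[], List.nodup_nil⟩)),
      C.reg⟩ := by
  simp only [Algorithm.step, hq]
  rfl

theorem step_collect {i h c t} (hq : C.proc q = Status.active (LocalState.collect i h c t)) :
    (renamingAlg n d).step C q =
      ⟨Function.update C.proc q (Status.active (collectNext i h c t (C.reg t))), C.reg⟩ := by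
  simp only [Algorithm.step, hq]
  rfl

theorem step_verify {i h c t} (hq : C.proc q = Status.active (LocalState.verify i h c t)) :
    (renamingAlg n d).step C q =
      ⟨Function.update C.proc q (Status.ofOutcome (verifyNext q i h c t (C.reg t))), C.reg⟩ := by
  simp only [Algorithm.step, hq]
  rfl

theorem step_write {i h} (hq : C.proc q = Status.active (LocalState.write i h)) :
    (renamingAlg n d).step C q =
      ⟨Function.update C.proc q (Status.active (LocalState.start i (h.extend q))),
        Function.update C.reg i (some (q, h.extend q))⟩ := by
  simp only [Algorithm.step, hq]
  rfl

theorem step_named {x} (hq : C.proc q = Status.named x) : (renamingAlg n d).step C q = C := by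
  simp only [Algorithm.step, hq]

theorem step_proc_of_ne {s : Fin n} (hs : q ≠ s) :
    ((renamingAlg n d).step C s).proc q = C.proc q := by
  rcases hC : C.proc s with _ | (⟨i, h, c, t⟩ | ⟨i, h, c, t⟩ | ⟨i, h⟩) | x
  · simp [step_idle hC, hs]
  · simp [step_collect hC, hs]
  · simp [step_verify hC, hs]
  · simp [step_write hC, hs]
  · simp [step_named hC]

/-- A step of `s` changes only registers to values with writer `s`. -/
theorem reg_of_step_reg {s w : Fin n} {h : Hist n} {j : Fin (d + 1)}
    (hr : ((renamingAlg n d).step C s).reg j = some (w, h)) (hw : w ≠ s) :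
    C.reg j = some (w, h) := by
  rcases hC : C.proc s with _ | (⟨i, h, c, t⟩ | ⟨i, h, c, t⟩ | ⟨i, h⟩) | x
  · simpa [step_idle hC] using hr
  · simpa [step_collect hC] using hr
  · simpa [step_verify hC] using hr
  · rw [step_write hC] at hr
    by_cases hj : j = i
    · subst hj
      simp only [Function.update_self, Option.some.injEq, Prod.mk.injEq] at hr
      exact absurd hr.1.symm hw
    · simpa [hj] using hr
  · simpa [step_named hC] using hr

end Steps

/-! ### Obstruction-freedom -/

section Solo

variable {n d : ℕ}

/-- Process `q` finishes when it runs alone from `C`. -/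
def SoloFinishes (q : Fin n) (C : (renamingAlg n d).Config) : Prop :=
  ∃ σ : List (Fin n), (∀ p ∈ σ, p = q) ∧ ((renamingAlg n d).run C σ).Finished q

variable {q : Fin n}

theorem SoloFinishes.of_step {C : (renamingAlg n d).Config}
    (h : SoloFinishes q ((renamingAlg n d).step C q)) : SoloFinishes q C := by
  obtain ⟨σ, hσ, hf⟩ := h
  exact ⟨q :: σ, by simpa using hσ, hf⟩

theorem soloFinishes_of_named {C : (renamingAlg n d).Config} {x : ℕ}
    (h : C.proc q = Status.named x) : SoloFinishes q C :=
  ⟨[], by simp, x, h⟩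

/-- `q` finishes alone whenever its status is `st` and the registers contain `R`. -/
def SoloFrom (q : Fin n) (R : Fin (d + 1) → RegVal n) (st : Status (LocalState n d)) : Prop :=
  ∀ C : (renamingAlg n d).Config, C.reg = R → C.proc q = st → SoloFinishes q C

variable {R : Fin (d + 1) → RegVal n}

theorem soloFrom_named (x : ℕ) : SoloFrom q R (.named x) :=
  fun _ _ h => soloFinishes_of_named h

theorem SoloFrom.collect_step {i h c t}
    (H : SoloFrom q R (.active (collectNext i h c t (R t)))) :
    SoloFrom q R (.active (.collect i h c t)) := by
  rintro C rfl hC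
  refine SoloFinishes.of_step ?_
  rw [step_collect hC]
  exact H _ rfl (Function.update_self ..)

theorem SoloFrom.verify_step {i h c t}
    (H : SoloFrom q R (Status.ofOutcome (verifyNext q i h c t (R t)))) :
    SoloFrom q R (.active (.verify i h c t)) := by
  rintro C rfl hC
  refine SoloFinishes.of_step ?_
  rw [step_verify hC]
  exact H _ rfl (Function.update_self ..)

theorem SoloFrom.write_step {i h}
    (H : SoloFrom q (Function.update R i (some (q, h.extend q)))
      (.active (.start i (h.extend q)))) :
    SoloFrom q R (.active (.write i h)) := by
  rintro C rfl hC
  refine SoloFinishes.of_step ?_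
  rw [step_write hC]
  exact H _ rfl (Function.update_self ..)

/-- A restart is only possible when the first pass, perhaps begun while others were running, differs
from the current registers. -/
theorem SoloFrom.verify {i h c} (H : SoloFrom q R (Status.ofOutcome (decision q i h c)))
    (Hs : c ≠ R → SoloFrom q R (.active (.start i h))) (t : Fin (d + 1)) :
    SoloFrom q R (.active (.verify i h c t)) := by
  induction t using Fin.reverseInduction with
  | last =>
    refine SoloFrom.verify_step ?_
    unfold verifyNext
    split_ifs with h1 h2
    · simp at h2
    · exact H
    · exact Hs (fun h => h1 (by rw [h]))
  | cast t ih =>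
    refine SoloFrom.verify_step ?_
    unfold verifyNext
    split_ifs with h1 h2
    · exact ih
    · simp at h2
    · exact Hs (fun h => h1 (by rw [h]))

theorem SoloFrom.collect {i h} (t : Fin (d + 1)) (c : Fin (d + 1) → RegVal n)
    (H : ∀ c' : Fin (d + 1) → RegVal n, (∀ a < t, c' a = c a) → (∀ a, t ≤ a → c' a = R a) →
      SoloFrom q R (.active (.verify i h c' 0))) :
    SoloFrom q R (.active (.collect i h c t)) := by
  induction t using Fin.reverseInduction generalizing c with
  | last =>
    refine SoloFrom.collect_step ?_
    unfold collectNext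
    rw [dif_neg (by simp)]
    refine H _ (fun a ha => ?_) (fun a ha => ?_)
    · simp [ha.ne]
    · obtain rfl : a = Fin.last d := le_antisymm (Fin.le_last a) ha
      simp
  | cast t ih =>
    refine SoloFrom.collect_step ?_
    unfold collectNext
    rw [dif_pos (by simp)]
    refine ih (Function.update c t.castSucc (R t.castSucc)) (fun c' h1 h2 => ?_)
    refine H c' (fun a ha => ?_) (fun a ha => ?_)
    · rw [h1 a (ha.trans (Fin.castSucc_lt_succ)), Function.update_of_ne ha.ne]
    · rcases ha.eq_or_lt with rfl | ha
      · rw [h1 _ (Fin.castSucc_lt_succ), Function.update_self]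
      · exact h2 a (Nat.succ_le_of_lt ha)

/-- Without interference a full double collect succeeds and shows exactly `R`, so one decision on
`R` is all that matters. -/
theorem SoloFrom.start {i h} (H : SoloFrom q R (Status.ofOutcome (decision q i h R))) :
    SoloFrom q R (.active (.start i h)) := by
  refine SoloFrom.collect 0 _ (fun c' _ h2 => ?_)
  obtain rfl : c' = R := funext fun a => h2 a (Fin.zero_le a)
  exact SoloFrom.verify H (fun h => absurd rfl h) 0

/-- The possible outcomes of a decision. -/
theorem decision_cases (q : Fin n) (i : Fin (d + 1)) (h : Hist n) (c : Fin (d + 1) → RegVal n) :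
    (∃ x, decision q i h c = Sum.inr x) ∨
    ∃ hw : ∃ j, Candidate (writers c) j,
      ((RegVal.hist (c (adopted q i (writers c) hw))).extend q = h ∧
        ∃ k, c k ≠ some (q, h) ∧ decision q i h c = Sum.inl (.write k h)) ∨
      ((RegVal.hist (c (adopted q i (writers c) hw))).extend q ≠ h ∧
        decision q i h c = Sum.inl
          (.write i ((RegVal.hist (c (adopted q i (writers c) hw))).extend q))) := by
  unfold decision
  split_ifs with h1 h2 h3
  · exact Or.inl ⟨_, rfl⟩
  · exact Or.inr ⟨h2, Or.inl ⟨h3, _, (not_forall.1 h1).choose_spec, rfl⟩⟩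
  · exact Or.inr ⟨h2, Or.inr ⟨h3, rfl⟩⟩
  · exact Or.inl ⟨_, rfl⟩

/-- With two registers of its own, one of them its last write, `q` fills up all registers. -/
theorem soloFrom_start_of_two {h : Hist n} (hq : q ∈ h.1) (k : ℕ) :
    ∀ (R : Fin (d + 1) → RegVal n) (i b : Fin (d + 1)),
      (Finset.univ.filter fun a => R a ≠ some (q, h)).card ≤ k → R i = some (q, h) → b ≠ i →
      writers R b = some q → SoloFrom q R (.active (.start i h)) := by
  induction k with
  | zero =>
    intro R i b hk hi hb hbq
    have hall : ∀ a, R a = some (q, h) := by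
      intro a
      by_contra ha
      have : a ∈ Finset.univ.filter fun a => R a ≠ some (q, h) := by simpa using ha
      rw [Finset.card_eq_zero.1 (Nat.le_zero.1 hk)] at this
      simp at this
    refine SoloFrom.start ?_
    unfold decision
    rw [dif_pos hall]
    exact soloFrom_named _
  | succ k ih =>
    intro R i b hk hi hb hbq
    refine SoloFrom.start ?_
    have hwi : writers R i = some q := by simp [writers, hi]
    rcases decision_cases q i h R with ⟨x, hx⟩ | ⟨hw, ⟨h1, j, hj, hd⟩ | ⟨h1, hd⟩⟩
    · rw [hx]
      exact soloFrom_named x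
    · rw [hd]
      have hij : i ≠ j := by
        rintro rfl
        exact hj hi
      refine SoloFrom.write_step ?_
      rw [Hist.extend_of_mem hq]
      -- The measure is the number of registers that differ from `(q, h)`; the write to `j` lowers
      -- it, and the old register `i` becomes the second one held by `q`.
      refine ih _ j i ?_ (by simp) hij (by simp [writers, hij, hi])
      refine Nat.le_of_lt_succ (lt_of_lt_of_le (Finset.card_lt_card ?_) hk)
      refine ⟨fun a ha => ?_, fun hsub => ?_⟩
      · have haj : a ≠ j := by
          rintro rfl
          simp at ha
        simpa [haj] using ha
      · have := hsub (by simpa using hj : j ∈ Finset.univ.filter fun a => R a ≠ some (q, h))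
        simp at this
    · refine absurd ?_ h1
      -- The last write shares its writer with `b`, hence is a candidate and takes precedence;
      -- extending it by `q` gives `h` back.
      have : adopted q i (writers R) hw = i := by
        unfold adopted
        rw [if_pos ⟨hwi, Or.inr ⟨b, hb, by rw [hbq, hwi]⟩⟩]
      rw [this, hi]
      exact Hist.extend_of_mem hq

theorem soloFrom_write_of_ne {h : Hist n} {i j : Fin (d + 1)} (hq : q ∈ h.1)
    (hi : R i = some (q, h)) (hj : R j ≠ some (q, h)) : SoloFrom q R (.active (.write j h)) := by
  have hij : i ≠ j := by
    rintro rfl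
    exact hj hi
  refine SoloFrom.write_step ?_
  rw [Hist.extend_of_mem hq]
  exact soloFrom_start_of_two hq _ _ j i le_rfl (by simp) hij (by simp [writers, hij, hi])

/-- The decision that was prepared by adopting a foreign history. -/
theorem soloFrom_decision_of_adopted {h : Hist n} {i : Fin (d + 1)} (hq : q ∈ h.1)
    (hi : R i = some (q, h))
    (H : ∀ hw, (RegVal.hist (R (adopted q i (writers R) hw))).extend q = h) :
    SoloFrom q R (.active (.start i h)) := by
  refine SoloFrom.start ?_
  rcases decision_cases q i h R with ⟨x, hx⟩ | ⟨hw, ⟨h1, j, hj, hd⟩ | ⟨h1, hd⟩⟩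
  · rw [hx]
    exact soloFrom_named x
  · rw [hd]
    exact soloFrom_write_of_ne hq hi hj
  · exact absurd (H hw) h1

/-- If `q` holds only register `i`, that register is no candidate, so the adopted entry is foreign
and survives the write to `i`. The writers do not change either, so the next double collect adopts
the same entry, now agrees with the history of `q`, and makes `q` take a second register. -/
theorem soloFrom_start_of_written {h : Hist n} {i : Fin (d + 1)} (hq : q ∈ h.1)
    (hi : R i = some (q, h)) : SoloFrom q R (.active (.start i h)) := by
  by_cases hb : ∃ b, b ≠ i ∧ writers R b = some q
  · obtain ⟨b, hb, hbq⟩ := hb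
    exact soloFrom_start_of_two hq _ R i b le_rfl hi hb hbq
  have hwi : writers R i = some q := by simp [writers, hi]
  refine SoloFrom.start ?_
  rcases decision_cases q i h R with ⟨x, hx⟩ | ⟨hw, ⟨h1, j, hj, hd⟩ | ⟨h1, hd⟩⟩
  · rw [hx]
    exact soloFrom_named x
  · rw [hd]
    exact soloFrom_write_of_ne hq hi hj
  · rw [hd]
    set h' := (RegVal.hist (R (adopted q i (writers R) hw))).extend q
    have hq' : q ∈ h'.1 := Hist.mem_extend _ _
    refine SoloFrom.write_step ?_
    rw [Hist.extend_of_mem hq']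
    refine soloFrom_decision_of_adopted hq' (by simp) (fun hw' => ?_)
    have hwr : writers (Function.update R i (some (q, h'))) = writers R := by
      funext a
      by_cases ha : a = i
      · subst ha
        simp [writers, hi]
      · simp [writers, ha]
    have hne : adopted q i (writers R) hw ≠ i := by
      intro he
      have := candidate_adopted q i (writers R) hw
      rw [he] at this
      rcases this with h0 | ⟨b, hbi, hbw⟩
      · rw [hwi] at h0
        cases h0
      · exact hb ⟨b, hbi, by rw [hbw, hwi]⟩
    -- Stated for a variable `w` because the proof that a candidate exists depends on it.
    have key : ∀ (w : Fin (d + 1) → Option (Fin n)) (hw' : ∃ j, Candidate w j),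
        w = writers R → adopted q i w hw' = adopted q i (writers R) hw := by
      rintro w hw' rfl
      rfl
    rw [key _ hw' hwr, Function.update_of_ne hne]

theorem soloFrom_write (i : Fin (d + 1)) (h : Hist n) :
    SoloFrom q R (.active (.write i h)) :=
  SoloFrom.write_step (soloFrom_start_of_written (Hist.mem_extend q h) (by simp))

/-- Here `c` may be stale: any decision either returns or leads to a write, after which the collects
are faithful. -/
theorem soloFrom_decision (i : Fin (d + 1)) (h : Hist n) (c : Fin (d + 1) → RegVal n) :
    SoloFrom q R (Status.ofOutcome (decision q i h c)) := by
  rcases decision_cases q i h c with ⟨x, hx⟩ | ⟨hw, ⟨h1, j, hj, hd⟩ | ⟨h1, hd⟩⟩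
  · rw [hx]
    exact soloFrom_named x
  · rw [hd]
    exact soloFrom_write _ _
  · rw [hd]
    exact soloFrom_write _ _

theorem soloFrom_start (i : Fin (d + 1)) (h : Hist n) : SoloFrom q R (.active (.start i h)) :=
  SoloFrom.start (soloFrom_decision i h R)

theorem soloFrom_verify (i : Fin (d + 1)) (h : Hist n) (c : Fin (d + 1) → RegVal n)
    (t : Fin (d + 1)) : SoloFrom q R (.active (.verify i h c t)) :=
  SoloFrom.verify (soloFrom_decision i h c) (fun _ => soloFrom_start i h) t

theorem obstructionFree_renaming (n d : ℕ) : (renamingAlg n d).ObstructionFree := by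
  intro C _ q
  change SoloFinishes q C
  rcases hC : C.proc q with _ | (⟨i, h, c, t⟩ | ⟨i, h, c, t⟩ | ⟨i, h⟩) | x
  · refine SoloFinishes.of_step ?_
    rw [step_idle hC]
    exact soloFrom_start _ _ _ rfl (Function.update_self ..)
  · exact SoloFrom.collect t c (fun c' _ _ => soloFrom_verify _ _ _ _) C rfl hC
  · exact soloFrom_verify _ _ _ _ C rfl hC
  · exact soloFrom_write _ _ C rfl hC
  · exact soloFinishes_of_named hC

end Solo


section Safety

variable {n d : ℕ}

/-! ### Contents of registers and local states -/

/-- The value proposes a history of participants, among them its writer. -/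
def RegVal.Honest (P : Fin n → Prop) (v : RegVal n) : Prop :=
  ∀ w h, v = some (w, h) → w ∈ h.1 ∧ ∀ x ∈ h.1, P x

theorem RegVal.Honest.mono {P Q : Fin n → Prop} (hPQ : ∀ x, P x → Q x) {v : RegVal n}
    (hv : v.Honest P) : v.Honest Q :=
  fun w h he => ⟨(hv w h he).1, fun x hx => hPQ x ((hv w h he).2 x hx)⟩

theorem RegVal.honest_none (P : Fin n → Prop) : RegVal.Honest P (none : RegVal n) := by
  intro w h he
  cases he

theorem RegVal.Honest.mem_hist {P : Fin n → Prop} {v : RegVal n} (hv : v.Honest P) :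
    ∀ x ∈ v.hist.1, P x := by
  rcases v with _ | ⟨w, h⟩
  · simp [RegVal.hist]
  · exact (hv w h rfl).2

/-- All histories in a local state consist of participants. -/
def LocalState.Honest (P : Fin n → Prop) : LocalState n d → Prop
  | .collect _ h c _ => (∀ x ∈ h.1, P x) ∧ ∀ a, (c a).Honest P
  | .verify _ h c _ => (∀ x ∈ h.1, P x) ∧ ∀ a, (c a).Honest P
  | .write _ h => ∀ x ∈ h.1, P x

theorem LocalState.Honest.mono {P Q : Fin n → Prop} (hPQ : ∀ x, P x → Q x) {s : LocalState n d}
    (hs : s.Honest P) : s.Honest Q := by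
  rcases s with ⟨i, h, c, t⟩ | ⟨i, h, c, t⟩ | ⟨i, h⟩
  · exact ⟨fun x hx => hPQ x (hs.1 x hx), fun a => (hs.2 a).mono hPQ⟩
  · exact ⟨fun x hx => hPQ x (hs.1 x hx), fun a => (hs.2 a).mono hPQ⟩
  · exact fun x hx => hPQ x (hs x hx)

theorem LocalState.honest_start {P : Fin n → Prop} {i : Fin (d + 1)} {h : Hist n}
    (hh : ∀ x ∈ h.1, P x) : (LocalState.start i h).Honest P :=
  ⟨hh, fun _ => RegVal.honest_none P⟩

theorem extend_participates {P : Fin n → Prop} {q : Fin n} {h : Hist n} (hq : P q)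
    (hh : ∀ x ∈ h.1, P x) : ∀ x ∈ (h.extend q).1, P x := by
  intro x hx
  rcases Hist.mem_of_mem_extend hx with rfl | hx
  · exact hq
  · exact hh x hx

theorem honest_update {P : Fin n → Prop} {c : Fin (d + 1) → RegVal n} {v : RegVal n}
    (hc : ∀ a, (c a).Honest P) (hv : v.Honest P) (t a : Fin (d + 1)) :
    (Function.update c t v a).Honest P := by
  by_cases ha : a = t
  · subst ha
    simpa using hv
  · simpa [ha] using hc a

theorem honest_collectNext {P : Fin n → Prop} {i h c} {t : Fin (d + 1)} {v : RegVal n}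
    (hs : (LocalState.collect i h c t).Honest P) (hv : v.Honest P) :
    (collectNext i h c t v).Honest P := by
  unfold collectNext
  split_ifs
  · exact ⟨hs.1, honest_update hs.2 hv t⟩
  · exact ⟨hs.1, honest_update hs.2 hv t⟩

theorem honest_decision {P : Fin n → Prop} {q : Fin n} {i : Fin (d + 1)} {h : Hist n}
    {c : Fin (d + 1) → RegVal n} (hq : P q) (hh : ∀ x ∈ h.1, P x) (hc : ∀ a, (c a).Honest P)
    {s : LocalState n d} (hs : decision q i h c = Sum.inl s) : s.Honest P := by
  rcases decision_cases q i h c with ⟨x, hx⟩ | ⟨hw, ⟨h1, k, hk, hd⟩ | ⟨h1, hd⟩⟩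
  · rw [hx] at hs
    cases hs
  · rw [hd] at hs
    cases hs
    exact hh
  · rw [hd] at hs
    cases hs
    exact extend_participates hq (hc _).mem_hist

theorem honest_verifyNext {P : Fin n → Prop} {q : Fin n} {i h c} {t : Fin (d + 1)} {v : RegVal n}
    (hq : P q) (hs : (LocalState.verify i h c t).Honest P) {s : LocalState n d}
    (h1 : verifyNext q i h c t v = Sum.inl s) : s.Honest P := by
  unfold verifyNext at h1
  split_ifs at h1
  · cases h1
    exact hs
  · exact honest_decision hq hs.1 hs.2 h1
  · cases h1
    exact LocalState.honest_start hs.1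

/-- All histories in a configuration consist of participants. -/
structure Honest (C : (renamingAlg n d).Config) : Prop where
  reg : ∀ j, RegVal.Honest C.Participates (C.reg j)
  proc : ∀ q (s : LocalState n d), C.proc q = Status.active s → s.Honest C.Participates

theorem participates_step {C : (renamingAlg n d).Config} {s x : Fin n} (hx : C.Participates x) :
    ((renamingAlg n d).step C s).Participates x := by
  by_cases hs : x = s
  · subst hs
    unfold Algorithm.Config.Participates at hx ⊢
    rcases hC : C.proc x with _ | (⟨i, h, c, t⟩ | ⟨i, h, c, t⟩ | ⟨i, h⟩) | y
    · exact absurd hC hx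
    · rw [step_collect hC]
      simp
    · rw [step_verify hC]
      rcases verifyNext x i h c t (C.reg t) with s | y <;> simp [Status.ofOutcome]
    · rw [step_write hC]
      simp
    · rw [step_named hC, hC]
      simp
  · unfold Algorithm.Config.Participates
    rw [step_proc_of_ne hs]
    exact hx

theorem Honest.step {C : (renamingAlg n d).Config} (hC : Honest C) (s : Fin n) :
    Honest ((renamingAlg n d).step C s) := by
  have mono : ∀ x, C.Participates x → ((renamingAlg n d).step C s).Participates x :=
    fun x => participates_step
  have other : ∀ q (l : LocalState n d), q ≠ s →
      ((renamingAlg n d).step C s).proc q = Status.active l →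
      l.Honest ((renamingAlg n d).step C s).Participates := by
    intro q l hq hl
    rw [step_proc_of_ne hq] at hl
    exact (hC.proc q l hl).mono mono
  rcases hs : C.proc s with _ | (⟨i, h, c, t⟩ | ⟨i, h, c, t⟩ | ⟨i, h⟩) | x
  · refine ⟨fun j => ?_, fun q l hl => ?_⟩
    · have : ((renamingAlg n d).step C s).reg j = C.reg j := by rw [step_idle hs]
      rw [this]
      exact (hC.reg j).mono mono
    · by_cases hq : q = s
      · subst hq
        have hl' := hl
        simp only [step_idle hs, Function.update_self] at hl'
        obtain rfl := Status.active.inj hl'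
        exact LocalState.honest_start (by simp)
      · exact other q l hq hl
  · have hp := hC.proc s _ hs
    refine ⟨fun j => ?_, fun q l hl => ?_⟩
    · have : ((renamingAlg n d).step C s).reg j = C.reg j := by rw [step_collect hs]
      rw [this]
      exact (hC.reg j).mono mono
    · by_cases hq : q = s
      · subst hq
        have hl' := hl
        simp only [step_collect hs, Function.update_self] at hl'
        obtain rfl := Status.active.inj hl'
        exact (honest_collectNext hp (hC.reg t)).mono mono
      · exact other q l hq hl
  · have hp := hC.proc s _ hs
    have hsp : C.Participates s := by simp [Algorithm.Config.Participates, hs]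
    refine ⟨fun j => ?_, fun q l hl => ?_⟩
    · have : ((renamingAlg n d).step C s).reg j = C.reg j := by rw [step_verify hs]
      rw [this]
      exact (hC.reg j).mono mono
    · by_cases hq : q = s
      · subst hq
        have hl' := hl
        simp only [step_verify hs, Function.update_self] at hl'
        rcases hv : verifyNext q i h c t (C.reg t) with l' | y
        · rw [hv] at hl'
          simp only [Status.ofOutcome] at hl'
          obtain rfl := Status.active.inj hl'
          exact (honest_verifyNext hsp hp hv).mono mono
        · rw [hv] at hl'
          cases hl'
      · exact other q l hq hl
  · have hp : ∀ x ∈ h.1, C.Participates x := hC.proc s _ hs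
    have hsp : C.Participates s := by simp [Algorithm.Config.Participates, hs]
    have he := extend_participates hsp hp
    refine ⟨fun j => ?_, fun q l hl => ?_⟩
    · by_cases hj : j = i
      · subst hj
        have : ((renamingAlg n d).step C s).reg j = some (s, h.extend s) := by
          rw [step_write hs]
          simp
        rw [this]
        rintro w h' ⟨⟩
        exact ⟨Hist.mem_extend _ _, fun x hx => mono x (he x hx)⟩
      · have : ((renamingAlg n d).step C s).reg j = C.reg j := by
          rw [step_write hs]
          simp [hj]
        rw [this]
        exact (hC.reg j).mono mono
    · by_cases hq : q = s
      · subst hq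
        have hl' := hl
        simp only [step_write hs, Function.update_self] at hl'
        obtain rfl := Status.active.inj hl'
        exact LocalState.honest_start fun x hx => mono x (he x hx)
      · exact other q l hq hl
  · rw [step_named hs]
    exact hC

/-! ### What happens after a process has filled all registers -/

/-- The last write of a process in this local state put `h` into register `j`, or the process is
about to write to `j`. -/
def LocalState.LastWrote (j : Fin (d + 1)) (h : Hist n) : LocalState n d → Prop
  | .collect i h' _ _ => i = j ∧ h' = h
  | .verify i h' _ _ => i = j ∧ h' = h
  | .write i _ => i = j

/-- The value extends the history `X`, or its writer belongs to `D`. -/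
def RegVal.Follows (X : Hist n) (D : Set (Fin n)) (v : RegVal n) : Prop :=
  ∃ w h, v = some (w, h) ∧ (X.1 <+: h.1 ∨ w ∈ D)

theorem RegVal.Follows.mono {X : Hist n} {D D' : Set (Fin n)} (hD : D ⊆ D') {v : RegVal n}
    (hv : v.Follows X D) : v.Follows X D' := by
  obtain ⟨w, h, rfl, hw⟩ := hv
  exact ⟨w, h, rfl, hw.imp_right fun hw => hD hw⟩

/-- The first `t` entries of a first pass `c` are sound: if an entry that does not extend `X` is
still in place, its writer does not show up later in the pass. -/
structure CollectSound (X : Hist n) (D : Set (Fin n)) (R c : Fin (d + 1) → RegVal n) (t : ℕ) :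
    Prop where
  follows : ∀ a : Fin (d + 1), a.1 < t → (c a).Follows X D
  unique : ∀ a : Fin (d + 1), a.1 < t → ∀ w h, c a = some (w, h) → ¬ X.1 <+: h.1 → R a = c a →
    ∀ b : Fin (d + 1), a < b → b.1 < t → ∀ h', c b ≠ some (w, h')

/-- A first pass `c` is sound when the first `t` entries are verified. -/
structure VerifySound (X : Hist n) (D : Set (Fin n)) (R c : Fin (d + 1) → RegVal n) (t : ℕ) :
    Prop where
  follows : ∀ a : Fin (d + 1), (c a).Follows X D
  unique : ∀ a : Fin (d + 1), ∀ w h, c a = some (w, h) → ¬ X.1 <+: h.1 → (a.1 < t ∨ R a = c a) →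
    ∀ b : Fin (d + 1), b ≠ a → (a.1 < t ∨ a < b ∨ b.1 < t) → ∀ h', c b ≠ some (w, h')

/-- The local state leads to writes that extend `X` only. -/
def LocalState.Sound (X : Hist n) (D : Set (Fin n)) (R : Fin (d + 1) → RegVal n) :
    LocalState n d → Prop
  | .collect _ _ c t => CollectSound X D R c t.1
  | .verify _ _ c t => VerifySound X D R c t.1
  | .write _ h => X.1 <+: h.1

/-- Process `q` has written since `X` filled all registers: at most one of its values in the
registers does not extend `X`, it overwrites that one next, and its further writes extend `X`. -/
structure Following (X : Hist n) (D : Set (Fin n)) (R : Fin (d + 1) → RegVal n) (q : Fin n)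
    (st : Status (LocalState n d)) : Prop where
  ne_idle : st ≠ Status.idle
  unique : ∀ j h, R j = some (q, h) → ¬ X.1 <+: h.1 →
    (∀ k h', R k = some (q, h') → k = j) ∧ ∀ s, st = Status.active s → s.LastWrote j h
  sound : ∀ s, st = Status.active s → s.Sound X D R

/-- At some time all registers contained `X` with writer `p`, and `D` is the set of processes
that have written since. -/
structure SecuredSince (p : Fin n) (X : Hist n) (D : Set (Fin n))
    (C : (renamingAlg n d).Config) : Prop where
  notMem : p ∉ D
  reg : ∀ j, ∃ w h, C.reg j = some (w, h) ∧ ((w = p ∧ h = X) ∨ w ∈ D)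
  proc : ∀ q ∈ D, Following X D C.reg q (C.proc q)

/-- The history `X` of `p` is secured. -/
def Secured (p : Fin n) (X : Hist n) (C : (renamingAlg n d).Config) : Prop :=
  ∃ D, SecuredSince p X D C

theorem secured_of_forall_reg {p : Fin n} {X : Hist n} {C : (renamingAlg n d).Config}
    (h : ∀ j, C.reg j = some (p, X)) : Secured p X C :=
  ⟨∅, by simp, fun j => ⟨p, X, h j, Or.inl ⟨rfl, rfl⟩⟩, by simp⟩

section Registers

variable {p : Fin n} {X : Hist n} {D : Set (Fin n)} {C : (renamingAlg n d).Config}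

theorem SecuredSince.follows (H : SecuredSince p X D C) (j : Fin (d + 1)) :
    (C.reg j).Follows X D := by
  obtain ⟨w, h, hr, ⟨rfl, rfl⟩ | hw⟩ := H.reg j
  · exact ⟨w, h, hr, Or.inl (List.prefix_refl _)⟩
  · exact ⟨w, h, hr, Or.inr hw⟩

/-- Values of `p` are all equal to `X`, so a value that does not extend `X` comes from a member of
`D`, which holds no other register at that moment. -/
theorem SecuredSince.eq_of_writer (H : SecuredSince p X D C) {j k : Fin (d + 1)} {w : Fin n}
    {h h' : Hist n} (hj : C.reg j = some (w, h)) (hX : ¬ X.1 <+: h.1)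
    (hk : C.reg k = some (w, h')) : k = j := by
  obtain ⟨w', h'', hr, ⟨rfl, rfl⟩ | hw⟩ := H.reg j
  · rw [hr] at hj
    cases hj
    exact absurd (List.prefix_refl _) hX
  · rw [hr] at hj
    cases hj
    exact ((H.proc _ hw).unique j _ hr hX).1 k h' hk

theorem SecuredSince.collectSound_read (H : SecuredSince p X D C) {c : Fin (d + 1) → RegVal n}
    {t : Fin (d + 1)} (hc : CollectSound X D C.reg c t.1) :
    CollectSound X D C.reg (Function.update c t (C.reg t)) (t.1 + 1) := by
  refine ⟨fun a ha => ?_, fun a ha w h hw hX hR b hab hb h' => ?_⟩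
  · by_cases hat : a = t
    · subst hat
      simpa using H.follows a
    · rw [Function.update_of_ne hat]
      exact hc.follows a (by have := Fin.val_ne_of_ne hat; omega)
  · have hab' : a.1 < b.1 := hab
    have hat : a ≠ t := by
      rintro rfl
      omega
    rw [Function.update_of_ne hat] at hw hR
    by_cases hbt : b = t
    · subst hbt
      rw [Function.update_self]
      intro hb'
      -- Entry `a` is still in place while `b` is read, so both values sit in the registers
      -- simultaneously.
      exact hab.ne' (H.eq_of_writer (hR.trans hw) hX hb')
    · rw [Function.update_of_ne hbt]
      have := Fin.val_ne_of_ne hbt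
      exact hc.unique a (by omega) w h hw hX hR b hab (by omega) h'

theorem CollectSound.verifySound {R c : Fin (d + 1) → RegVal n}
    (hc : CollectSound X D R c (d + 1)) : VerifySound X D R c 0 := by
  refine ⟨fun a => hc.follows a a.2, fun a w h hw hX hR b hba hab h' => ?_⟩
  simp only [Nat.not_lt_zero, false_or, or_false] at hR hab
  exact hc.unique a a.2 w h hw hX hR b hab b.2 h'

/-- An entry `a` stays in place between its two readings. For `b > a` the first reading of `b` falls
into that interval, for `b < a` the second one does. Either way `c a` and `c b` were in the
registers together. This is what the second pass is for. -/
theorem SecuredSince.verifySound_read (H : SecuredSince p X D C) {c : Fin (d + 1) → RegVal n}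
    {t : Fin (d + 1)} (hc : VerifySound X D C.reg c t.1) (ht : C.reg t = c t) :
    VerifySound X D C.reg c (t.1 + 1) := by
  refine ⟨hc.follows, fun a w h hw hX hR b hba hab h' => ?_⟩
  have hR' : a.1 < t.1 ∨ C.reg a = c a := by
    rcases hR with hR | hR
    · rcases Nat.lt_succ_iff_lt_or_eq.1 hR with hR | hR
      · exact Or.inl hR
      · obtain rfl : a = t := Fin.ext hR
        exact Or.inr ht
    · exact Or.inr hR
  by_cases hab' : a.1 < t.1 ∨ a < b ∨ b.1 < t.1
  · exact hc.unique a w h hw hX hR' b hba hab' h'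
  · simp only [not_or, not_lt] at hab'
    obtain ⟨h1, h2, h3⟩ := hab'
    have h2' : b.1 ≤ a.1 := h2
    have hne := Fin.val_ne_of_ne hba
    -- The only new pairs are those with `b = t < a`, where `a` has not been verified yet but is
    -- still in place.
    obtain rfl : b = t := Fin.ext (by omega)
    intro hb
    rcases hR' with hR' | hR'
    · omega
    · exact hba (H.eq_of_writer (hR'.trans hw) hX (ht.trans hb))

/-- In a verified double collect all candidates extend `X`. -/
theorem VerifySound.prefix_of_candidate {R c : Fin (d + 1) → RegVal n}
    (hc : VerifySound X D R c (d + 1)) {j : Fin (d + 1)} (hj : Candidate (writers c) j) :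
    X.1 <+: (RegVal.hist (c j)).1 := by
  obtain ⟨w, h, hw, -⟩ := hc.follows j
  by_contra hX
  rcases hj with hj | ⟨b, hb, hbj⟩
  · simp [writers, hw] at hj
  · obtain ⟨w', h', hw', -⟩ := hc.follows b
    simp only [writers, hw, hw', Option.map_some, Option.some.injEq] at hbj
    subst hbj
    rw [hw] at hX
    exact hc.unique j _ h hw hX (Or.inl j.2) b hb (Or.inl j.2) h' hw'

/-- Whatever is written next contains an adopted history and therefore extends `X`. If the old `h`
did not, the history changes, and the write goes to the register that holds `h`. -/
theorem VerifySound.decision {R c : Fin (d + 1) → RegVal n} {q : Fin n} {i : Fin (d + 1)}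
    {h : Hist n} (hc : VerifySound X D R c (d + 1)) {s : LocalState n d}
    (hs : decision q i h c = Sum.inl s) :
    s.Sound X D R ∧ (¬ X.1 <+: h.1 → s.LastWrote i h) := by
  rcases decision_cases q i h c with ⟨x, hx⟩ | ⟨hw, H⟩
  · rw [hx] at hs
    cases hs
  · have hX := (hc.prefix_of_candidate (candidate_adopted q i _ hw)).trans
      (Hist.prefix_extend q _)
    rcases H with ⟨h1, k, hk, hd⟩ | ⟨h1, hd⟩
    · rw [hd] at hs
      cases hs
      rw [h1] at hX
      exact ⟨hX, fun h2 => absurd hX h2⟩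
    · rw [hd] at hs
      cases hs
      exact ⟨hX, fun _ => rfl⟩

/-- A step that leaves the registers alone. -/
theorem SecuredSince.of_reg_eq {C' : (renamingAlg n d).Config} (H : SecuredSince p X D C)
    (hreg : C'.reg = C.reg)
    (hproc : ∀ q ∈ D, C'.proc q = C.proc q ∨ Following X D C.reg q (C'.proc q)) :
    SecuredSince p X D C' := by
  refine ⟨H.notMem, by rw [hreg]; exact H.reg, fun q hq => ?_⟩
  rw [hreg]
  rcases hproc q hq with h | h
  · rw [h]
    exact H.proc q hq
  · exact h

/-- The process of a `Following` moves to a new local state, the registers remain. -/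
theorem Following.of_active {R : Fin (d + 1) → RegVal n} {q : Fin n} {s s' : LocalState n d}
    (H : Following X D R q (.active s)) (hsound : s'.Sound X D R)
    (hlast : ∀ j h, ¬ X.1 <+: h.1 → s.LastWrote j h → s'.LastWrote j h) :
    Following X D R q (.active s') := by
  refine ⟨by simp, fun j h hj hX => ⟨(H.unique j h hj hX).1, ?_⟩, ?_⟩
  · rintro _ ⟨⟩
    exact hlast j h hX ((H.unique j h hj hX).2 s rfl)
  · rintro _ ⟨⟩
    exact hsound

theorem Following.of_named {R : Fin (d + 1) → RegVal n} {q : Fin n} {s : LocalState n d} {x : ℕ}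
    (H : Following X D R q (.active s)) : Following X D R q (.named x) := by
  refine ⟨by simp, fun j h hj hX => ⟨(H.unique j h hj hX).1, ?_⟩, ?_⟩
  · rintro _ ⟨⟩
  · rintro _ ⟨⟩

theorem collectSound_start {R : Fin (d + 1) → RegVal n} :
    CollectSound X D R (fun _ => none) 0 :=
  ⟨fun _ ha => absurd ha (Nat.not_lt_zero _), fun _ ha => absurd ha (Nat.not_lt_zero _)⟩

theorem SecuredSince.collectNext (H : SecuredSince p X D C) {q : Fin n} {i h c t}
    (hF : Following X D C.reg q (.active (.collect i h c t))) :
    Following X D C.reg q (.active (collectNext i h c t (C.reg t))) := by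
  have hc := H.collectSound_read (hF.sound _ rfl : CollectSound X D C.reg c t.1)
  unfold Renaming.collectNext
  split_ifs with ht
  · exact hF.of_active hc fun j h _ => id
  · have : t.1 + 1 = d + 1 := by omega
    rw [this] at hc
    exact hF.of_active hc.verifySound fun j h _ => id

theorem SecuredSince.verifyNext (H : SecuredSince p X D C) {q : Fin n} {i h c t}
    (hF : Following X D C.reg q (.active (.verify i h c t))) :
    Following X D C.reg q (Status.ofOutcome (verifyNext q i h c t (C.reg t))) := by
  have hc : VerifySound X D C.reg c t.1 := hF.sound _ rfl
  unfold Renaming.verifyNext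
  split_ifs with h1 ht
  · exact hF.of_active (H.verifySound_read hc h1) fun j h _ => id
  · have hc := H.verifySound_read hc h1
    have : t.1 + 1 = d + 1 := by omega
    rw [this] at hc
    rcases hd : decision q i h c with s | x
    · refine hF.of_active (hc.decision hd).1 ?_
      rintro j h' hX ⟨rfl, rfl⟩
      exact (hc.decision hd).2 hX
    · exact hF.of_named
  · exact hF.of_active collectSound_start fun j h _ => id

/-- Soundness survives a write of `s`, which from now on belongs to the set of writers. -/
theorem LocalState.Sound.write {R : Fin (d + 1) → RegVal n} {s : Fin n} {i : Fin (d + 1)}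
    {v : Hist n} (hs : s ∈ D → X.1 <+: v.1) {l : LocalState n d} (hl : l.Sound X D R) :
    l.Sound X (insert s D) (Function.update R i (some (s, v))) := by
  -- No ABA problem: the writer of an entry that does not extend `X` lies in `D`, and members of `D`
  -- only write extensions of `X`. Once overwritten, such an entry never reappears.
  have key : ∀ c : Fin (d + 1) → RegVal n, ∀ a, (c a).Follows X D →
      ∀ w h, c a = some (w, h) → ¬ X.1 <+: h.1 →
      Function.update R i (some (s, v)) a = c a → R a = c a := by
    intro c a hf w h hw hX ha
    by_cases hai : a = i
    · subst hai
      rw [Function.update_self, hw] at ha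
      cases ha
      obtain ⟨w', h', hw', h1 | h1⟩ := hf
      · rw [hw] at hw'
        cases hw'
        exact absurd h1 hX
      · rw [hw] at hw'
        cases hw'
        exact absurd (hs h1) hX
    · simpa [hai] using ha
  rcases l with ⟨j, h, c, t⟩ | ⟨j, h, c, t⟩ | ⟨j, h⟩
  · refine ⟨fun a ha => (hl.follows a ha).mono (Set.subset_insert _ _), ?_⟩
    intro a ha w h' hw hX hR
    exact hl.unique a ha w h' hw hX (key c a (hl.follows a ha) w h' hw hX hR)
  · refine ⟨fun a => (hl.follows a).mono (Set.subset_insert _ _), ?_⟩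
    intro a w h' hw hX hR
    exact hl.unique a w h' hw hX (hR.imp_right (key c a (hl.follows a) w h' hw hX))
  · exact hl

/-- A first write since `X` was secured is arbitrary, but then `s` holds no other register. Any
later write extends `X` and, if an outdated value of `s` is left, lands on it. -/
theorem SecuredSince.write (H : SecuredSince p X D C) {s : Fin n} {i h} (hsp : s ≠ p)
    (hs : C.proc s = Status.active (LocalState.write i h)) :
    SecuredSince p X (insert s D) ((renamingAlg n d).step C s) := by
  have hext : s ∈ D → X.1 <+: (h.extend s).1 := fun hD =>
    ((H.proc s hD).sound _ hs : X.1 <+: h.1).trans (Hist.prefix_extend _ _)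
  refine ⟨?_, fun j => ?_, fun q hq => ?_⟩
  · rintro (hp | hp)
    · exact hsp hp.symm
    · exact H.notMem hp
  · rw [step_write hs]
    by_cases hj : j = i
    · subst hj
      exact ⟨s, h.extend s, by simp, Or.inr (Set.mem_insert _ _)⟩
    · obtain ⟨w, h', hr, hw⟩ := H.reg j
      exact ⟨w, h', by simpa [hj] using hr, hw.imp_right (Set.mem_insert_of_mem _)⟩
  · by_cases hqs : q = s
    · subst hqs
      have hpq : ((renamingAlg n d).step C q).proc q =
          Status.active (LocalState.start i (h.extend q)) := by
        rw [step_write hs]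
        exact Function.update_self ..
      have hreg : ((renamingAlg n d).step C q).reg =
          Function.update C.reg i (some (q, h.extend q)) := by rw [step_write hs]
      rw [hpq, hreg]
      refine ⟨by simp, fun j h' hj hX => ?_, ?_⟩
      · by_cases hji : j = i
        · subst hji
          rw [Function.update_self] at hj
          cases hj
          have hD : q ∉ D := fun hD => hX (hext hD)
          refine ⟨fun k h' hk => ?_, ?_⟩
          · by_contra hkj
            rw [Function.update_of_ne hkj] at hk
            obtain ⟨w, h'', hr, ⟨rfl, -⟩ | hw⟩ := H.reg k
            · rw [hr] at hk
              cases hk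
              exact hsp rfl
            · rw [hr] at hk
              cases hk
              exact hD hw
          · rintro _ ⟨⟩
            exact ⟨rfl, rfl⟩
        · rw [Function.update_of_ne hji] at hj
          have hD : q ∈ D := by
            obtain ⟨w, h'', hr, ⟨rfl, -⟩ | hw⟩ := H.reg j
            · rw [hr] at hj
              cases hj
              exact absurd rfl hsp
            · rw [hr] at hj
              cases hj
              exact hw
          -- An outdated value of `q` would sit in the register that `q` is overwriting, which is
          -- `i` and not `j`.
          exact absurd (((H.proc q hD).unique j h' hj hX).2 _ hs).symm hji
      · rintro _ ⟨⟩
        exact collectSound_start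
    · have hF := H.proc q (hq.resolve_left hqs)
      rw [step_proc_of_ne hqs, step_write hs]
      refine ⟨hF.ne_idle, fun j h' hj hX => ?_, fun l hl => (hF.sound l hl).write hext⟩
      have aux : ∀ k g, Function.update C.reg i (some (s, h.extend s)) k = some (q, g) →
          C.reg k = some (q, g) := by
        intro k g hk
        by_cases hki : k = i
        · subst hki
          rw [Function.update_self] at hk
          cases hk
          exact absurd rfl hqs
        · simpa [hki] using hk
      exact ⟨fun k g hk => (hF.unique j h' (aux j h' hj) hX).1 k g (aux k g hk),
        (hF.unique j h' (aux j h' hj) hX).2⟩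

/-- A secured history stays secured as long as its owner does not write. -/
theorem Secured.step (H : Secured p X C) (s : Fin n)
    (hs : s = p → ((renamingAlg n d).step C s).reg = C.reg) :
    Secured p X ((renamingAlg n d).step C s) := by
  obtain ⟨D, H⟩ := H
  by_cases hsp : s = p
  · refine ⟨D, H.of_reg_eq (hs hsp) fun q hq => Or.inl (step_proc_of_ne ?_)⟩
    rintro rfl
    exact H.notMem (hsp ▸ hq)
  rcases hC : C.proc s with _ | (⟨i, h, c, t⟩ | ⟨i, h, c, t⟩ | ⟨i, h⟩) | x
  · refine ⟨D, H.of_reg_eq (by rw [step_idle hC]) fun q hq => Or.inl (step_proc_of_ne ?_)⟩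
    rintro rfl
    exact (H.proc q hq).ne_idle hC
  · refine ⟨D, H.of_reg_eq (by rw [step_collect hC]) fun q hq => ?_⟩
    by_cases hqs : q = s
    · subst hqs
      right
      rw [step_collect hC]
      simp only [Function.update_self]
      exact H.collectNext (hC ▸ H.proc q hq)
    · exact Or.inl (step_proc_of_ne hqs)
  · refine ⟨D, H.of_reg_eq (by rw [step_verify hC]) fun q hq => ?_⟩
    by_cases hqs : q = s
    · subst hqs
      right
      rw [step_verify hC]
      simp only [Function.update_self]
      exact H.verifyNext (hC ▸ H.proc q hq)
    · exact Or.inl (step_proc_of_ne hqs)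
  · exact ⟨_, H.write hsp hC⟩
  · rw [step_named hC]
    exact ⟨D, H⟩

/-- If `q` fills all of at least two registers after `X` was secured, it extends `X`. -/
theorem Secured.prefix_of_forall_reg (hd : d ≠ 0) (H : Secured p X C) {q : Fin n} {Y : Hist n}
    (hY : ∀ j, C.reg j = some (q, Y)) : X.1 <+: Y.1 := by
  obtain ⟨D, H⟩ := H
  by_contra hX
  have := H.eq_of_writer (hY 0) hX (hY (Fin.last d))
  have := congrArg Fin.val this
  simp at this
  exact hd this

end Registers

end Safety


/-! ### Locked histories and the global invariant. -/

section Invariant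

variable {n d : ℕ}

theorem decision_eq_inr {q : Fin n} {i : Fin (d + 1)} {h : Hist n}
    {c : Fin (d + 1) → RegVal n} {x : ℕ} (hx : decision q i h c = Sum.inr x) :
    ((∀ a, c a = some (q, h)) ∧ x = h.1.idxOf q + 1) ∨
      (¬ (∃ j, Candidate (writers c) j) ∧ x = n + 1 + q) := by
  unfold decision at hx
  split_ifs at hx with h1 h2 h3
  · cases hx
    exact Or.inl ⟨h1, rfl⟩
  · cases hx
    exact Or.inr ⟨h2, rfl⟩

/-- A process gets its name in the last step of a double collect. -/
theorem exists_decision_of_named {C : (renamingAlg n d).Config} {s : Fin n} {x : ℕ}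
    (hx : ((renamingAlg n d).step C s).proc s = Status.named x)
    (hC : ∀ y, C.proc s ≠ Status.named y) :
    ∃ i h c t, C.proc s = Status.active (LocalState.verify i h c t) ∧
      decision s i h c = Sum.inr x := by
  rcases hs : C.proc s with _ | (⟨i, h, c, t⟩ | ⟨i, h, c, t⟩ | ⟨i, h⟩) | y
  · simp [step_idle hs] at hx
  · simp [step_collect hs] at hx
  · refine ⟨i, h, c, t, rfl, ?_⟩
    simp only [step_verify hs, Function.update_self] at hx
    unfold verifyNext at hx
    split_ifs at hx
    · cases hx
    · rcases hd : decision s i h c with l | y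
      · rw [hd] at hx
        cases hx
      · rw [hd] at hx
        cases hx
        rfl
    · cases hx
  · simp [step_write hs] at hx
  · exact absurd hs (hC y)

/-- All that `p` has read in its current double collect is its own value `X`, as are the registers
that it still has to read in the first pass; or `p` has returned with the history `g = X`. -/
def LockedStatus (g : Hist n) (p : Fin n) (X : Hist n) (R : Fin (d + 1) → RegVal n) :
    Status (LocalState n d) → Prop
  | .idle => False
  | .active (.collect _ h c t) =>
      h = X ∧ (∀ a < t, c a = some (p, X)) ∧ ∀ a, t ≤ a → R a = some (p, X)
  | .active (.verify _ h c _) => h = X ∧ ∀ a, c a = some (p, X)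
  | .active (.write _ _) => False
  | .named x => g = X ∧ x ≤ n

/-- Process `p` is about to return with the history `X`, or has done so, where `G` records the
histories with which processes return. -/
def Locked (G : Fin n → Hist n) (C : (renamingAlg n d).Config) (p : Fin n) (X : Hist n) : Prop :=
  p ∈ X.1 ∧ LockedStatus (G p) p X C.reg (C.proc p)

/-- The recorded histories after a step of `s`. -/
def nextRecord (G : Fin n → Hist n) (s : Fin n) : Status (LocalState n d) → Fin n → Hist n
  | .active (.verify _ h _ _) => Function.update G s h
  | _ => G

theorem nextRecord_of_ne {G : Fin n → Hist n} {s p : Fin n} (hp : p ≠ s)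
    (st : Status (LocalState n d)) : nextRecord G s st p = G p := by
  rcases st with _ | (⟨i, h, c, t⟩ | ⟨i, h, c, t⟩ | ⟨i, h⟩) | y <;> simp [nextRecord, hp]

/-- Read backwards in time: while `p` collects, others can only destroy its values, so being locked
propagates back to the start of the first pass. There no register has been read yet, and all of them
must contain `(p, X)`. After the name is returned nothing changes any more. -/
theorem Locked.of_step {G : Fin n → Hist n} {C : (renamingAlg n d).Config} {s p : Fin n}
    {X : Hist n} (H : Locked (nextRecord G s (C.proc s)) ((renamingAlg n d).step C s) p X) :
    (Locked G C p X ∧ (s = p → ((renamingAlg n d).step C s).reg = C.reg)) ∨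
      ∀ j, ((renamingAlg n d).step C s).reg j = some (p, X) := by
  obtain ⟨hp, H⟩ := H
  by_cases hps : p = s
  swap
  · refine Or.inl ⟨⟨hp, ?_⟩, fun h => absurd h.symm hps⟩
    rw [show nextRecord G s (C.proc s) p = G p from nextRecord_of_ne hps _, step_proc_of_ne hps] at H
    rcases hC : C.proc p with _ | (⟨i, h, c, t⟩ | ⟨i, h, c, t⟩ | ⟨i, h⟩) | y
    all_goals rw [hC] at H
    · exact H
    · exact ⟨H.1, H.2.1, fun a ha => reg_of_step_reg (H.2.2 a ha) hps⟩
    · exact H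
    · exact H
    · exact H
  subst hps
  have hstart : ∀ i h, ((renamingAlg n d).step C p).proc p =
      Status.active (LocalState.start i h) →
      ∀ j, ((renamingAlg n d).step C p).reg j = some (p, X) := by
    intro i h hst
    rw [hst] at H
    exact fun j => H.2.2 j (Fin.zero_le j)
  rcases hC : C.proc p with _ | (⟨i, h, c, t⟩ | ⟨i, h, c, t⟩ | ⟨i, h⟩) | y
  · exact Or.inr (hstart _ _ (by rw [step_idle hC]; exact Function.update_self ..))
  · have hst : ((renamingAlg n d).step C p).proc p =
        Status.active (collectNext i h c t (C.reg t)) := by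
      rw [step_collect hC]
      exact Function.update_self ..
    have hreg : ((renamingAlg n d).step C p).reg = C.reg := by rw [step_collect hC]
    rw [hst, hreg] at H
    refine Or.inl ⟨⟨hp, ?_⟩, fun _ => hreg⟩
    rw [hC]
    unfold collectNext at H
    split_ifs at H with ht
    · obtain ⟨h1, h2, h3⟩ := H
      refine ⟨h1, fun a ha => ?_, fun a ha => ?_⟩
      · have := h2 a (Fin.lt_def.2 (Nat.lt_succ_of_lt ha))
        rwa [Function.update_of_ne ha.ne] at this
      · rcases ha.eq_or_lt with rfl | ha
        · have := h2 t (Fin.lt_def.2 (Nat.lt_succ_self _))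
          rwa [Function.update_self] at this
        · exact h3 a (Fin.le_def.2 (Nat.succ_le_of_lt ha))
    · obtain ⟨h1, h2⟩ := H
      refine ⟨h1, fun a ha => ?_, fun a ha => ?_⟩
      · have := h2 a
        rwa [Function.update_of_ne ha.ne] at this
      · obtain rfl : a = t := Fin.ext (by have := Fin.le_def.1 ha; omega)
        have := h2 a
        rwa [Function.update_self] at this
  · have hst : ((renamingAlg n d).step C p).proc p =
        Status.ofOutcome (verifyNext p i h c t (C.reg t)) := by
      rw [step_verify hC]
      exact Function.update_self ..
    have hreg : ((renamingAlg n d).step C p).reg = C.reg := by rw [step_verify hC]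
    by_cases hv : C.reg t = c t
    · refine Or.inl ⟨⟨hp, ?_⟩, fun _ => hreg⟩
      rw [hst, hreg, hC] at H
      rw [hC]
      unfold verifyNext at H
      rw [if_pos hv] at H
      split_ifs at H with ht
      · exact H
      · rcases decision_cases p i h c with ⟨x, hx⟩ | ⟨hw, ⟨h1, k, hk, hd⟩ | ⟨h1, hd⟩⟩
        · rw [hx] at H
          obtain ⟨h1, h2⟩ := H
          -- The record made in this very step is the history of the verifying process.
          obtain rfl : h = X := by simpa [nextRecord] using h1
          rcases decision_eq_inr hx with ⟨h3, -⟩ | ⟨-, h3⟩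
          · exact ⟨rfl, h3⟩
          · omega
        · rw [hd] at H
          exact H.elim
        · rw [hd] at H
          exact H.elim
    · refine Or.inr (hstart i h ?_)
      rw [hst]
      unfold verifyNext
      rw [if_neg hv]
      rfl
  · exact Or.inr (hstart _ _ (by rw [step_write hC]; exact Function.update_self ..))
  · rw [step_named hC] at H ⊢
    rw [hC] at H
    refine Or.inl ⟨⟨hp, ?_⟩, fun _ => rfl⟩
    rw [hC]
    exact H

/-- The invariant of the algorithm. -/
structure Invariant (G : Fin n → Hist n) (C : (renamingAlg n d).Config) : Prop where
  honest : Honest C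
  named : ∀ p x, C.proc p = Status.named x →
    x = n + 1 + p ∨ (p ∈ (G p).1 ∧ x = (G p).1.idxOf p + 1)
  secured : ∀ p X, Locked G C p X → Secured p X C
  comparable : ∀ p X q Y, p ≠ q → Locked G C p X → Locked G C q Y → X.1 <+: Y.1 ∨ Y.1 <+: X.1

theorem invariant_initConfig (G : Fin n → Hist n) :
    Invariant G (renamingAlg n d).initConfig where
  honest := ⟨fun _ => RegVal.honest_none _, fun _ _ h => by cases h⟩
  named := fun _ _ h => by cases h
  secured := fun _ _ h => h.2.elim
  comparable := fun _ _ _ _ _ h => h.2.elim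

/-- For comparability, consider the process that becomes locked later. At that moment it fills all
registers, while the history of the other one is already secured, so it extends that history. -/
theorem Invariant.step (hd : d ≠ 0) {G : Fin n → Hist n} {C : (renamingAlg n d).Config}
    (H : Invariant G C) (s : Fin n) :
    Invariant (nextRecord G s (C.proc s)) ((renamingAlg n d).step C s) := by
  have hsec : ∀ p X, Locked (nextRecord G s (C.proc s)) ((renamingAlg n d).step C s) p X →
      Secured p X ((renamingAlg n d).step C s) := by
    intro p X hL
    rcases hL.of_step with ⟨hL, hreg⟩ | hreg
    · exact (H.secured p X hL).step s hreg
    · exact secured_of_forall_reg hreg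
  refine ⟨H.honest.step s, fun p x hx => ?_, hsec, fun p X q Y hpq hp hq => ?_⟩
  · by_cases hps : p = s
    swap
    · rw [show nextRecord G s (C.proc s) p = G p from nextRecord_of_ne hps _]
      rw [step_proc_of_ne hps] at hx
      exact H.named p x hx
    subst hps
    by_cases hC : ∃ y, C.proc p = Status.named y
    · obtain ⟨y, hC⟩ := hC
      rw [step_named hC] at hx
      rw [hC]
      exact H.named p x hx
    · obtain ⟨i, h, c, t, hC, hdec⟩ := exists_decision_of_named hx (not_exists.1 hC)
      have hg : nextRecord G p (C.proc p) p = h := by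
        rw [hC]
        exact Function.update_self ..
      rw [hg]
      rcases decision_eq_inr hdec with ⟨h1, h2⟩ | ⟨-, h2⟩
      · exact Or.inr ⟨((H.honest.proc p _ hC).2 0 _ _ (h1 0)).1, h2⟩
      · exact Or.inl h2
  · rcases hp.of_step with ⟨hp', -⟩ | hreg
    · rcases hq.of_step with ⟨hq', -⟩ | hreg
      · exact H.comparable p X q Y hpq hp' hq'
      · exact Or.inl ((hsec p X hp).prefix_of_forall_reg hd hreg)
    · exact Or.inr ((hsec q Y hq).prefix_of_forall_reg hd hreg)

theorem exists_invariant (hd : d ≠ 0) {C : (renamingAlg n d).Config}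
    (hC : (renamingAlg n d).Reachable C) : ∃ G, Invariant G C := by
  obtain ⟨σ, rfl⟩ := hC
  induction σ using List.reverseRecOn with
  | nil => exact ⟨_, invariant_initConfig fun _ => ⟨[], List.nodup_nil⟩⟩
  | append_singleton σ s ih =>
    obtain ⟨G, H⟩ := ih
    have : (renamingAlg n d).run (renamingAlg n d).initConfig (σ ++ [s]) =
        (renamingAlg n d).step ((renamingAlg n d).run (renamingAlg n d).initConfig σ) s := by
      simp [Algorithm.run]
    rw [this]
    exact ⟨_, H.step hd s⟩

/-! ### Distinctness and size of the names. -/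

theorem idxOf_eq_of_prefix {α : Type*} [DecidableEq α] {l l' : List α} {a : α} (h : l <+: l')
    (ha : a ∈ l) : l'.idxOf a = l.idxOf a := by
  obtain ⟨r, rfl⟩ := h
  exact List.idxOf_append_of_mem ha

theorem eq_of_idxOf_of_prefix {α : Type*} [DecidableEq α] {l l' : List α} {a b : α}
    (h : l <+: l') (ha : a ∈ l) (hab : l.idxOf a = l'.idxOf b) : a = b := by
  rw [← idxOf_eq_of_prefix h ha] at hab
  exact (List.idxOf_inj (h.subset ha)).1 hab

theorem length_hist_le (h : Hist n) : h.1.length ≤ n := by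
  simpa using h.2.length_le_card

/-- Private names exceed `n` and determine their owner. Two processes with names at most `n` are
both locked, and the same position in two comparable histories is occupied by the same process. -/
theorem Invariant.distinct {G : Fin n → Hist n} {C : (renamingAlg n d).Config}
    (H : Invariant G C) {p q : Fin n} {x : ℕ} (hp : C.Owns p x) (hq : C.Owns q x) : p = q := by
  have hle : ∀ {p : Fin n}, p ∈ (G p).1 → (G p).1.idxOf p + 1 ≤ n := fun {p} hp =>
    (List.idxOf_lt_length_of_mem hp).trans_le (length_hist_le _)
  rcases H.named p x hp with h1 | ⟨h1, h2⟩ <;> rcases H.named q x hq with h3 | ⟨h3, h4⟩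
  · exact Fin.ext (by omega)
  · have := hle h3
    omega
  · have := hle h1
    omega
  · by_contra hpq
    have hLp : Locked G C p (G p) := by
      refine ⟨h1, ?_⟩
      rw [show C.proc p = Status.named x from hp]
      exact ⟨rfl, h2 ▸ hle h1⟩
    have hLq : Locked G C q (G q) := by
      refine ⟨h3, ?_⟩
      rw [show C.proc q = Status.named x from hq]
      exact ⟨rfl, h4 ▸ hle h3⟩
    rcases H.comparable p _ q _ hpq hLp hLq with h | h
    · exact hpq (eq_of_idxOf_of_prefix h h1 (by omega))
    · exact hpq (eq_of_idxOf_of_prefix h h3 (by omega)).symm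

theorem length_le_numParticipants {C : (renamingAlg n d).Config} {h : Hist n}
    (hh : ∀ x ∈ h.1, C.Participates x) : h.1.length ≤ C.numParticipants := by
  rw [← List.toFinset_card_of_nodup h.2, ← Set.ncard_coe_finset]
  exact Set.ncard_le_ncard (fun x hx => hh x (by simpa using hx)) (Set.toFinite _)

theorem numParticipants_le (C : (renamingAlg n d).Config) : C.numParticipants ≤ n := by
  simpa [Algorithm.Config.numParticipants] using Set.ncard_le_card {p : Fin n | C.Participates p}

theorem numParticipants_le_step (C : (renamingAlg n d).Config) (s : Fin n) :
    C.numParticipants ≤ ((renamingAlg n d).step C s).numParticipants :=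
  Set.ncard_le_ncard (fun _ hx => participates_step hx) (Set.toFinite _)

/-- Without candidates all registers have different writers. -/
theorem lt_numParticipants_of_not_candidate {C : (renamingAlg n d).Config}
    {c : Fin (d + 1) → RegVal n} (hc : ∀ a, (c a).Honest C.Participates)
    (hno : ¬ ∃ j, Candidate (writers c) j) : d < C.numParticipants := by
  have hsome : ∀ a, ∃ w, writers c a = some w := by
    intro a
    rcases hw : writers c a with _ | w
    · exact absurd ⟨a, Or.inl hw⟩ hno
    · exact ⟨w, rfl⟩
  choose w hw using hsome
  have hinj : Function.Injective w := by
    intro a b hab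
    by_contra hne
    exact hno ⟨b, Or.inr ⟨a, hne, by rw [hw, hw, hab]⟩⟩
  have hrange : Set.range w ⊆ {p : Fin n | C.Participates p} := by
    rintro _ ⟨a, rfl⟩
    have ha := hw a
    rcases hca : c a with _ | ⟨v, h⟩
    · simp [writers, hca] at ha
    · simp only [writers, hca, Option.map_some, Option.some.injEq] at ha
      subst ha
      exact (hc a _ h hca).2 _ (hc a _ h hca).1
  have hcard := Set.ncard_le_ncard hrange (Set.toFinite _)
  rw [← Set.image_univ, Set.ncard_image_of_injective _ hinj, Set.ncard_univ,
    Nat.card_eq_fintype_card, Fintype.card_fin] at hcard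
  exact hcard

/-- A name is bounded by the number of participants, unless there are more than `d` of them. -/
theorem Invariant.name_le {G : Fin n → Hist n} {C : (renamingAlg n d).Config}
    (H : Invariant G C) {p : Fin n} {x : ℕ} (hp : ¬ C.Finished p)
    (hx : ((renamingAlg n d).step C p).Owns p x) :
    1 ≤ x ∧ (x ≤ C.numParticipants ∨ (d < C.numParticipants ∧ x ≤ 2 * n)) := by
  obtain ⟨i, h, c, t, hC, hdec⟩ := exists_decision_of_named hx fun y hy => hp ⟨y, hy⟩
  obtain ⟨hh, hc⟩ := H.honest.proc p _ hC
  rcases decision_eq_inr hdec with ⟨h1, rfl⟩ | ⟨h1, rfl⟩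
  · refine ⟨Nat.le_add_left _ _, Or.inl ?_⟩
    have hmem : p ∈ h.1 := (hc 0 _ _ (h1 0)).1
    exact (Nat.succ_le_of_lt (List.idxOf_lt_length_of_mem hmem)).trans
      (length_le_numParticipants hh)
  · refine ⟨by omega, Or.inr ⟨lt_numParticipants_of_not_candidate hc h1, ?_⟩⟩
    have := p.2
    omega

end Invariant

end Renaming

theorem mainTheorem8 (n : ℕ) (f : ℕ → ℕ)
    (hmono : MonotoneOn f (Set.Icc 1 n))
    (hf : ∀ k ∈ Set.Icc 1 n, k ≤ f k)
    (hf1 : f 1 < n)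
    (d : ℕ) (hd : IsLeast (insert n {x | x ∈ Set.Icc 1 n ∧ 2 * n ≤ f x}) d) :
    ∃ (V : Type) (_ : Finite V) (A : Renaming.Algorithm n (d + 1) V),
      A.IsAdaptiveRenaming f ∧ A.ObstructionFree := by
  -- At least two registers are needed for agreement; `f 1 < n` excludes `n = 0`.
  have hd0 : d ≠ 0 := by
    rcases hd.1 with rfl | ⟨⟨h1, -⟩, -⟩ <;> omega
  refine ⟨Renaming.RegVal n, inferInstance, Renaming.renamingAlg n d, ⟨?_, ?_⟩,
    Renaming.obstructionFree_renaming n d⟩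
  · intro C hC p q x hp hq
    obtain ⟨G, H⟩ := Renaming.exists_invariant hd0 hC
    exact H.distinct hp hq
  · intro C hC p x hp hx _
    obtain ⟨G, H⟩ := Renaming.exists_invariant hd0 hC
    obtain ⟨h1, h2⟩ := H.name_le hp hx
    have hk := Renaming.numParticipants_le_step C p
    have hkn := Renaming.numParticipants_le ((Renaming.renamingAlg n d).step C p)
    refine ⟨h1, ?_⟩
    rcases h2 with h2 | ⟨h2, h3⟩
    · exact (h2.trans hk).trans (hf _ ⟨by omega, hkn⟩)
    -- A private name means more than `d` participants. For `d = n` there are not that many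
    -- processes; otherwise monotonicity carries `2 * n ≤ f d` up to the number of participants.
    · rcases hd.1 with rfl | ⟨hdn, hfd⟩
      · omega
      · exact h3.trans (hfd.trans (hmono hdn ⟨by omega, hkn⟩ (by omega)))
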